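/- Let $\mathfrak g$ be a finite-dimensional reductive (for instance, semisimple) Lie algebra over $\mathbb C$, and let $G$ be its adjoint group, i.e. the group of automorphisms of $\mathfrak g$ generated by all $\exp(\operatorname{ad} x)$, $x\in\mathfrak g$. An element $e\in\mathfrak g$ is called nilpotent if $e\in[\mathfrak g,\mathfrak g]$ and $\operatorname{ad} e$ is a nilpotent endomorphism of $\mathfrak g$ (the first condition is automatic if $\mathfrak g$ is semisimple). Write $\mathcal O_e = G\cdot e$; a nonzero nilpotent orbit is a set of the form $\mathcal O_e$ with $e$ a nonzero nilpotent element. An $\mathfrak{sl}_2$-triple in $\mathfrak g$ is a triple $\{e,h,f\}$ of elements of $\mathfrak g$, not all zero, with $[e,f]=h$, $[h,e]=2e$, $[h,f]=-2f$; the group $G$ acts on such triples by acting on each member. Then the map $$\Omega:\{\mathfrak{sl}_2\text{-triples in }\mathfrak g\}/G\longrightarrow\{\text{nonzero nilpotent orbits in }\mathfrak g\},$$ sending the $G$-conjugacy class of $\{e,h,f\}$ to $\mathcal O_e$, is well defined and is a bijection. -/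

import Mathlib

/-! # The adjoint group, nilpotent orbits and sl₂-triples of a complex Lie algebra -/

noncomputable section

namespace NilpotentOrbits

variable (𝔤 : Type*) [LieRing 𝔤] [LieAlgebra ℂ 𝔤]

/-- The group `Aut(𝔤)` of Lie algebra automorphisms, as a subgroup of `GL(𝔤)`. -/
def lieAut : Subgroup (𝔤 ≃ₗ[ℂ] 𝔤) where
  carrier := {φ | ∀ x y : 𝔤, φ ⁅x, y⁆ = ⁅φ x, φ y⁆}
  mul_mem' {φ ψ} hφ hψ x y := by
    simp only [Set.mem_ofPred_eq] at hφ hψ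
    simp [LinearEquiv.mul_apply, hφ, hψ]
  one_mem' x y := rfl
  inv_mem' {φ} hφ x y := by
    simp only [Set.mem_ofPred_eq] at hφ
    change φ.symm ⁅x, y⁆ = ⁅φ.symm x, φ.symm y⁆
    rw [LinearEquiv.symm_apply_eq, hφ]
    simp

variable {𝔤} in
/-- The exponential `exp A = ∑ Aⁿ / n!` of an endomorphism of a finite dimensional complex vector
space. The endomorphism algebra carries its canonical (`ℂ`-module) topology, which in finite
dimension is the only Hausdorff vector space topology. -/
def expEnd [FiniteDimensional ℂ 𝔤] (A : Module.End ℂ 𝔤) : Module.End ℂ 𝔤 :=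
  letI : TopologicalSpace (Module.End ℂ 𝔤) := moduleTopology ℂ (Module.End ℂ 𝔤)
  haveI : IsModuleTopology ℂ (Module.End ℂ 𝔤) := ⟨rfl⟩
  haveI : IsTopologicalRing (Module.End ℂ 𝔤) :=
    IsModuleTopology.isTopologicalRing ℂ (Module.End ℂ 𝔤)
  NormedSpace.exp A

variable [FiniteDimensional ℂ 𝔤]

/-- The adjoint group of `𝔤`: the subgroup of `Aut(𝔤)` generated by all `exp (ad x)`, `x ∈ 𝔤`. -/
def adjointGroup : Subgroup (lieAut 𝔤) :=
  Subgroup.closure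
    {φ | ∃ x : 𝔤, ((φ : 𝔤 ≃ₗ[ℂ] 𝔤) : Module.End ℂ 𝔤) = expEnd (LieAlgebra.ad ℂ 𝔤 x)}

variable {𝔤}

lemma adjointGroup_smul_lie (g : adjointGroup 𝔤) (x y : 𝔤) : g • ⁅x, y⁆ = ⁅g • x, g • y⁆ :=
  g.1.2 x y

/-- Nilpotent elements of a reductive Lie algebra `𝔤`: elements `e` of `[𝔤, 𝔤]` such that `ad e` is
a nilpotent endomorphism. (If `𝔤` is semisimple, then `[𝔤, 𝔤] = 𝔤`.) -/
def IsNilpotentElement (e : 𝔤) : Prop :=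
  e ∈ LieAlgebra.derivedSeries ℂ 𝔤 1 ∧ IsNilpotent (LieAlgebra.ad ℂ 𝔤 e)

variable (𝔤)

/-- The set of nonzero nilpotent orbits: the orbits `𝒪ₑ` of the adjoint group through the nonzero
nilpotent elements `e`. -/
def nonzeroNilpotentOrbits : Set (Set 𝔤) :=
  {O | ∃ e : 𝔤, e ≠ 0 ∧ IsNilpotentElement e ∧ O = MulAction.orbit (adjointGroup 𝔤) e}

/-- The standard sl₂-triples `{e, h, f}` in `𝔤`: `[e, f] = h`, `[h, e] = 2e`, `[h, f] = -2f`,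
not all zero (equivalently `h ≠ 0`). -/
@[ext] structure SlTwoTriple where
  e : 𝔤
  h : 𝔤
  f : 𝔤
  isSl2Triple : IsSl2Triple h e f

variable {𝔤}

/-- The adjoint group acts on sl₂-triples by conjugation, `g • {e, h, f} = {g e, g h, g f}`. -/
instance : MulAction (adjointGroup 𝔤) (SlTwoTriple 𝔤) where
  smul g t :=
    { e := g • t.e
      h := g • t.h
      f := g • t.f
      isSl2Triple :=
        { h_ne_zero := (smul_ne_zero_iff_ne g).2 t.isSl2Triple.h_ne_zero
          lie_e_f := by rw [← adjointGroup_smul_lie, t.isSl2Triple.lie_e_f]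
          lie_h_e_nsmul := by
            rw [← adjointGroup_smul_lie, t.isSl2Triple.lie_h_e_nsmul, two_smul, two_smul, smul_add]
          lie_h_f_nsmul := by
            rw [← adjointGroup_smul_lie, t.isSl2Triple.lie_h_f_nsmul, two_smul, two_smul, smul_neg,
              smul_add] } }
  one_smul t := SlTwoTriple.ext (one_smul _ t.e) (one_smul _ t.h) (one_smul _ t.f)
  mul_smul g g' t :=
    SlTwoTriple.ext (mul_smul g g' t.e) (mul_smul g g' t.h) (mul_smul g g' t.f)

lemma isNilpotent_ad_e (t : SlTwoTriple 𝔤) : IsNilpotent (LieAlgebra.ad ℂ 𝔤 t.e) := by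
  set E := LieAlgebra.ad ℂ 𝔤 t.e with hE
  set H := LieAlgebra.ad ℂ 𝔤 t.h with hH
  have h1 : H * E - E * H = 2 • E := by
    ext x
    have := leibniz_lie t.h t.e x
    rw [t.isSl2Triple.lie_h_e_nsmul, nsmul_lie] at this
    simp [hE, hH, this]
  have h2 (n : ℕ) : H * E ^ n - E ^ n * H = (2 * n) • E ^ n := by
    induction n with
    | zero => simp
    | succ n ih =>
      have : H * E ^ (n + 1) - E ^ (n + 1) * H
          = (H * E ^ n - E ^ n * H) * E + E ^ n * (H * E - E * H) := by
        rw [pow_succ]; noncomm_ring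
      rw [this, ih, h1, smul_mul_assoc, ← pow_succ, mul_smul_comm, ← pow_succ, ← add_smul]
      ring_nf
  by_contra hnil
  have h3 (n : ℕ) : Module.End.HasEigenvalue
      (LinearMap.mulLeft ℂ H - LinearMap.mulRight ℂ H) ((2 * n : ℕ) : ℂ) := by
    refine Module.End.hasEigenvalue_of_hasEigenvector (x := E ^ n) ⟨?_, fun h => hnil ⟨n, h⟩⟩
    rw [Module.End.mem_eigenspace_iff, Nat.cast_smul_eq_nsmul]
    simpa using h2 n
  refine Set.infinite_of_injective_forall_mem (f := fun n : ℕ => ((2 * n : ℕ) : ℂ)) ?_ h3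
    (Module.End.finite_hasEigenvalue _)
  intro a b hab
  simpa using hab

lemma isNilpotentElement_e (t : SlTwoTriple 𝔤) : IsNilpotentElement t.e := by
  refine ⟨?_, isNilpotent_ad_e t⟩
  have h : t.e = (2⁻¹ : ℂ) • ⁅t.h, t.e⁆ := by
    rw [t.isSl2Triple.lie_h_e_smul ℂ, smul_smul]; simp
  rw [h]
  exact Submodule.smul_mem _ _ (LieSubmodule.lie_mem_lie (LieSubmodule.mem_top _)
    (LieSubmodule.mem_top _))

variable (𝔤)

/-- The map `Ω` from the set of `G`-conjugacy classes of sl₂-triples to the set of nonzero nilpotent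
orbits, sending the class of `{e, h, f}` to `𝒪ₑ`. -/
def Omega : MulAction.orbitRel.Quotient (adjointGroup 𝔤) (SlTwoTriple 𝔤) →
    nonzeroNilpotentOrbits 𝔤 :=
  Quotient.lift
    (fun t => ⟨MulAction.orbit (adjointGroup 𝔤) t.e,
      t.e, t.isSl2Triple.e_ne_zero, isNilpotentElement_e t, rfl⟩)
    (by
      rintro a b ⟨g, rfl⟩
      exact Subtype.ext (MulAction.orbit_eq_iff.2 ⟨g, rfl⟩))

end NilpotentOrbits

end

/-!
Let `π` denote `ad : 𝔤 → ad 𝔤`. As the radical of `𝔤` is its center, `ad 𝔤` has trivial radical, so by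
Cartan's criterion its Killing form `κ` is nondegenerate.

Surjectivity of `Ω` is the Jacobson-Morozov theorem. Suppose first that the Killing form is
nondegenerate and that `ad e` is nilpotent. If `[e, [e, z]] = 0`, then `ad e ∘ ad z` is nilpotent
(`isNilpotent_mul_of_commute_commutator`), so `e` is orthogonal to the kernel of `(ad e)²` and hence
lies in the image of `(ad e)²`. This gives `h ∈ [e, 𝔤]` with `[h, e] = 2e`. From
`[Eᵏ⁺¹, Z] = (k + 1) (H - k) Eᵏ` one sees that a product of factors `H - k` with `k ≥ 0` kills the
centralizer of `e` (`prod_sub_ad_apply_eq_zero`); so `ad h + 2` is invertible there, and an `f` exists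
(`exists_isSl2Triple_of_lie_eq`). In the reductive case a neutral element is found in `ad 𝔤` and
lifted: `π` is injective on `[𝔤, 𝔤]`, because 2-cocycles on `ad 𝔤` are coboundaries, derivations being
inner (`eq_zero_of_mem_derivedSeries_of_map_eq_zero`).

Injectivity is Kostant's theorem (`exists_smul_eq_of_e_eq`). If `{e, h, f}` and `{e, h', f'}` are
triples, then `h' - h` lies in the kernel and in the image of `ad e`, where the weights of `h` are
positive integers. If `w` is the component of least weight `k` of `h' - h`, then `exp (ad x)` with
`x = -w / k` fixes `e` and moves `h` to `h + w` up to terms of higher weight. Finitely many such steps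
make `h = h'`, and then `f = f'`, since `f - f'` is a vector of weight `-2` of the centralizer of `e`.
-/

namespace NilpotentOrbits

/-! ### Nilpotency of a product in an associative algebra -/

theorem pow_succ_mul_sub_of_commute {A : Type*} [Ring A] {E Z : A}
    (hD : Commute E (E * Z - Z * E)) (k : ℕ) :
    E ^ (k + 1) * Z - Z * E ^ (k + 1) = (k + 1) • ((E * Z - Z * E) * E ^ k) := by
  induction k with
  | zero => simp
  | succ k ih =>
    have h : E ^ (k + 2) * Z - Z * E ^ (k + 2)
        = E * (E ^ (k + 1) * Z - Z * E ^ (k + 1)) + (E * Z - Z * E) * E ^ (k + 1) := by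
      rw [pow_succ' E (k + 1)]; noncomm_ring
    rw [h, ih, mul_smul_comm, ← mul_assoc, hD.eq, mul_assoc, ← pow_succ', succ_nsmul _ (k + 1)]

/-- A form of Jacobson's lemma: a commutator with a nilpotent element `E` which commutes with `E` is
nilpotent. If `Dᵃ Eᵏ⁺¹ = 0`, where `D = [E, Z]`, then `Dᵃ [Eᵏ⁺¹, Z] Dᵃ = 0`, which says that
`D²ᵃ⁺¹ Eᵏ = 0`; so the exponent of `E` descends to `0`. -/
theorem isNilpotent_commutator (K : Type*) {A : Type*} [Field K] [CharZero K] [Ring A]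
    [Algebra K A] {E Z : A} (hE : IsNilpotent E) (hD : Commute E (E * Z - Z * E)) :
    IsNilpotent (E * Z - Z * E) := by
  obtain ⟨N, hN⟩ := hE
  set D := E * Z - Z * E with hDdef
  suffices h : ∀ k, (∃ a, D ^ a * E ^ k = 0) → ∃ a, D ^ a * E ^ 0 = 0 by
    obtain ⟨a, ha⟩ := h N ⟨0, by simp [hN]⟩
    exact ⟨a, by simpa using ha⟩
  intro k
  induction k with
  | zero => exact id
  | succ k ih =>
    rintro ⟨a, ha⟩
    refine ih ⟨2 * a + 1, ?_⟩
    have h1 : D ^ a * (E ^ (k + 1) * Z - Z * E ^ (k + 1)) * D ^ a = 0 := by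
      have h2 : E ^ (k + 1) * D ^ a = 0 := by
        rw [(hD.pow_pow (k + 1) a).eq, ha]
      rw [mul_sub, ← mul_assoc, ha, zero_mul, zero_sub, neg_mul, mul_assoc, mul_assoc, h2]
      simp
    rw [pow_succ_mul_sub_of_commute hD, mul_smul_comm, smul_mul_assoc, ← hDdef,
      ← Nat.cast_smul_eq_nsmul K] at h1
    have h3 := (smul_eq_zero.1 h1).resolve_left (by exact_mod_cast k.succ_ne_zero)
    rw [← h3, mul_assoc, mul_assoc, (hD.pow_pow k a).eq, ← mul_assoc D, ← pow_succ', ← mul_assoc,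
      ← pow_add]
    congr 2; omega

/-- In characteristic zero, if a nilpotent `E` commutes with `D = [E, Z]`, then `E Z` is nilpotent:
on the filtration by the kernels of the powers of `E`, the product `E Z` acts through multiples of
`D`, which is itself nilpotent. -/
theorem isNilpotent_mul_of_commute_commutator (K : Type*) {A : Type*} [Field K] [CharZero K]
    [Ring A] [Algebra K A] {E Z : A} (hE : IsNilpotent E) (hD : Commute E (E * Z - Z * E)) :
    IsNilpotent (E * Z) := by
  obtain ⟨p, hp⟩ := isNilpotent_commutator K hE hD
  obtain ⟨N, hN⟩ := hE
  have key (k : ℕ) (a : A) (ha : E ^ (k + 1) * a = 0) (j : ℕ) :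
      E ^ k * ((E * Z) ^ j * a) = (k + 1) ^ j • ((E * Z - Z * E) ^ j * (E ^ k * a)) := by
    induction j with
    | zero => simp
    | succ j ih =>
      set b := (E * Z) ^ j * a with hb
      have hb0 : E ^ (k + 1) * b = 0 := by
        rw [pow_succ', mul_assoc, ih, mul_smul_comm, ← mul_assoc, (hD.pow_right j).eq, mul_assoc,
          ← mul_assoc E, ← pow_succ', ha, mul_zero, smul_zero]
      have h1 : E ^ (k + 1) * Z * b = (k + 1) • ((E * Z - Z * E) * E ^ k * b) := by
        have := congr($(pow_succ_mul_sub_of_commute hD k) * b)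
        rwa [sub_mul, mul_assoc Z, hb0, mul_zero, sub_zero, smul_mul_assoc] at this
      calc E ^ k * ((E * Z) ^ (j + 1) * a) = E ^ (k + 1) * Z * b := by
            rw [hb, pow_succ', pow_succ]; simp only [mul_assoc]
        _ = (k + 1) ^ (j + 1) • ((E * Z - Z * E) ^ (j + 1) * (E ^ k * a)) := by
            rw [h1, mul_assoc, ih, mul_smul_comm, smul_smul, ← mul_assoc, ← pow_succ', ← pow_succ']
  -- Since `(E Z)ᵖ` maps `ker Eᵏ⁺¹` into `ker Eᵏ`, its powers descend the filtration.
  have desc (d : ℕ) : ∀ k, k + d = N → E ^ k * (E * Z) ^ (p * d) = 0 := by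
    induction d with
    | zero => rintro k rfl; simpa using hN
    | succ d ih =>
      intro k hk
      have h1 := ih (k + 1) (by omega)
      have h2 := key k _ h1 p
      rwa [hp, zero_mul, smul_zero, ← pow_add, add_comm p, ← Nat.mul_succ] at h2
  exact ⟨p * N, by simpa using desc N 0 (by simp)⟩

/-! ### Neutral elements from the Killing form -/

section Killing

variable {K L : Type*} [Field K] [CharZero K] [LieRing L] [LieAlgebra K L]

/-- If `[e, [e, z]] = 0`, then `ad e` commutes with `[ad e, ad z]`, so `ad e ∘ ad z` is nilpotent and
has trace zero. -/
theorem killingForm_apply_eq_zero_of_lie_lie_eq_zero [FiniteDimensional K L] {e z : L}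
    (he : IsNilpotent (LieAlgebra.ad K L e)) (hz : ⁅e, ⁅e, z⁆⁆ = 0) :
    killingForm K L e z = 0 := by
  rw [LieModule.traceForm_apply_apply]
  refine (LinearMap.isNilpotent_trace_of_isNilpotent ?_).eq_zero
  refine isNilpotent_mul_of_commute_commutator K he ?_
  have h : LieAlgebra.ad K L e * LieAlgebra.ad K L z - LieAlgebra.ad K L z * LieAlgebra.ad K L e
      = LieAlgebra.ad K L ⁅e, z⁆ := by
    ext x; simp
  change Commute _ (LieAlgebra.ad K L e * LieAlgebra.ad K L z -
    LieAlgebra.ad K L z * LieAlgebra.ad K L e)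
  rw [h]
  refine LinearMap.ext fun x => ?_
  simpa [hz] using leibniz_lie e ⁅e, z⁆ x

/-- By invariance of the Killing form, the orthogonal complement of the image of `(ad e)²` is the
kernel of `(ad e)²`; since `e` is orthogonal to this kernel, it lies in the image. -/
theorem exists_lie_lie_eq_self [FiniteDimensional K L] [LieAlgebra.IsKilling K L] {e : L}
    (he : IsNilpotent (LieAlgebra.ad K L e)) : ∃ y : L, ⁅e, ⁅e, y⁆⁆ = e := by
  set κ := killingForm K L
  have hnd : κ.Nondegenerate := LieAlgebra.IsKilling.killingForm_nondegenerate K L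
  have hrefl : κ.IsRefl := (LieModule.traceForm_isSymm K L L).isRefl
  let W : Submodule K L := LinearMap.range (LieAlgebra.ad K L e ^ 2)
  suffices h : e ∈ W by
    obtain ⟨y, hy⟩ := h
    exact ⟨y, by simpa [pow_two] using hy⟩
  rw [← LinearMap.BilinForm.orthogonal_orthogonal hnd hrefl W]
  intro z hz
  have hz0 : ⁅e, ⁅e, z⁆⁆ = 0 := by
    refine hnd.1 _ fun y => ?_
    have h1 : κ ⁅e, ⁅e, y⁆⁆ z = 0 := hz _ ⟨y, by simp [pow_two]⟩
    rw [LieModule.traceForm_apply_lie_apply', LieModule.traceForm_apply_lie_apply', neg_neg] at h1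
    rw [LieModule.traceForm_comm]
    exact h1
  have := killingForm_apply_eq_zero_of_lie_lie_eq_zero he hz0
  change κ z e = 0
  rw [LieModule.traceForm_comm]
  exact this

end Killing

/-! ### Weights on the kernel of a nilpotent endomorphism -/

section Weights

variable {K V : Type*} [Field K] [CharZero K] [AddCommGroup V] [Module K V]
  {E H Z : Module.End K V}

/-- The commutation relation `[Eᵏ⁺¹, Z] = (k + 1) (H - k) Eᵏ`. Only `[E, Z] = H` and `[H, E] = 2E` are
used: `Z` need not complete `E` and `H` to an `sl₂`-triple. -/
theorem pow_succ_mul_sub_mul_pow_succ (hH : E * Z - Z * E = H) (hHE : H * E - E * H = 2 • E)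
    (k : ℕ) : E ^ (k + 1) * Z - Z * E ^ (k + 1) =
      (k + 1) • ((H - algebraMap K (Module.End K V) k) * E ^ k) := by
  induction k with
  | zero => simp [hH]
  | succ k ih =>
    have h : E ^ (k + 2) * Z - Z * E ^ (k + 2)
        = E * (E ^ (k + 1) * Z - Z * E ^ (k + 1)) + (E * Z - Z * E) * E ^ (k + 1) := by
      rw [pow_succ' E (k + 1)]; noncomm_ring
    have hEH : E * H = H * E - 2 • E := by rw [← hHE]; abel
    rw [h, ih, hH, mul_smul_comm, ← mul_assoc, mul_sub, hEH, ← Algebra.commutes]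
    simp only [map_natCast, sub_mul, mul_assoc, ← pow_succ', nsmul_eq_mul]
    push_cast
    noncomm_ring

/-- Each vector of `ker E ∩ im Eᵐ` is moved by `∏ (H - k)`, `m ≤ k < n`, into `im Eⁿ`. -/
theorem prod_sub_apply_mem_range_pow (hH : E * Z - Z * E = H) (hHE : H * E - E * H = 2 • E)
    {m : ℕ} (d : ℕ) {v : V} (hv : E v = 0) (hm : v ∈ LinearMap.range (E ^ m)) :
    E (Polynomial.aeval H (∏ k ∈ Finset.Ico m (m + d),
        (Polynomial.X - Polynomial.C (k : K))) v) = 0 ∧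
      Polynomial.aeval H (∏ k ∈ Finset.Ico m (m + d),
        (Polynomial.X - Polynomial.C (k : K))) v ∈ LinearMap.range (E ^ (m + d)) := by
  induction d with
  | zero => simpa [hv] using hm
  | succ d ih =>
    obtain ⟨h1, w, hw⟩ := ih
    rw [← add_assoc, Finset.prod_Ico_succ_top (by omega), mul_comm, map_mul, Module.End.mul_apply]
    set u := Polynomial.aeval H (∏ k ∈ Finset.Ico m (m + d),
        (Polynomial.X - Polynomial.C (k : K))) v
    have hX : Polynomial.aeval H (Polynomial.X - Polynomial.C ((m + d : ℕ) : K)) =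
      H - algebraMap K (Module.End K V) ((m + d : ℕ) : K) := by simp
    rw [hX]
    constructor
    · have := congr($hHE u)
      simp [h1] at this ⊢
      simpa using this
    · have := congr($(pow_succ_mul_sub_mul_pow_succ hH hHE (m + d)) w)
      have h0 : (E ^ (m + d + 1)) w = 0 := by rw [pow_succ', Module.End.mul_apply, hw, h1]
      rw [LinearMap.sub_apply, Module.End.mul_apply, Module.End.mul_apply, h0, map_zero, sub_zero,
        LinearMap.smul_apply, Module.End.mul_apply, hw, ← Nat.cast_smul_eq_nsmul K] at this
      refine ⟨((m + d + 1 : ℕ) : K)⁻¹ • Z w, ?_⟩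
      rw [map_smul, this, inv_smul_smul₀]
      exact_mod_cast (m + d).succ_ne_zero

end Weights

/-! ### Morozov's lemma and the semisimple Jacobson-Morozov theorem -/

section Morozov

variable {K L : Type*} [Field K] [LieRing L] [LieAlgebra K L]

theorem ad_mul_sub_mul_ad (x y : L) :
    LieAlgebra.ad K L x * LieAlgebra.ad K L y - LieAlgebra.ad K L y * LieAlgebra.ad K L x =
      LieAlgebra.ad K L ⁅x, y⁆ := by
  ext z; simp

theorem aeval_ad_apply {h v : L} {c : K} (hv : ⁅h, v⁆ = c • v) (P : Polynomial K) :
    Polynomial.aeval (LieAlgebra.ad K L h) P v = P.eval c • v :=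
  Module.End.aeval_apply_of_mem_apply_eq_smul hv

variable [CharZero K]

theorem prod_sub_ad_apply_eq_zero {e h z : L} (hz : ⁅e, z⁆ = h) (he : ⁅h, e⁆ = 2 • e) {m N : ℕ}
    (hmN : m ≤ N) (hN : LieAlgebra.ad K L e ^ N = 0) {v : L} (hv : ⁅e, v⁆ = 0)
    (hm : v ∈ LinearMap.range (LieAlgebra.ad K L e ^ m)) :
    Polynomial.aeval (LieAlgebra.ad K L h) (∏ k ∈ Finset.Ico m N,
      (Polynomial.X - Polynomial.C (k : K))) v = 0 := by
  obtain ⟨d, rfl⟩ := Nat.exists_eq_add_of_le hmN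
  have := (prod_sub_apply_mem_range_pow (K := K) (E := LieAlgebra.ad K L e)
    (H := LieAlgebra.ad K L h) (Z := LieAlgebra.ad K L z) (by rw [ad_mul_sub_mul_ad, hz])
    (by rw [ad_mul_sub_mul_ad, he, map_nsmul]) d (by simpa using hv) hm).2
  rw [hN] at this
  obtain ⟨w, hw⟩ := this
  rw [← hw, LinearMap.zero_apply]

/-- The weights of `h` on the centralizer of `e` are natural numbers. This holds before `e` and `h` are
known to be part of an `sl₂`-triple, as Morozov's lemma requires. -/
theorem exists_natCast_of_lie_eq_smul {e h z : L} (hz : ⁅e, z⁆ = h) (he : ⁅h, e⁆ = 2 • e) {N : ℕ}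
    (hN : LieAlgebra.ad K L e ^ N = 0) {v : L} (hv : ⁅e, v⁆ = 0) {c : K} (hc : ⁅h, v⁆ = c • v)
    (hv0 : v ≠ 0) : ∃ n < N, c = n := by
  have h1 := prod_sub_ad_apply_eq_zero hz he (Nat.zero_le N) hN hv (by simp)
  rw [aeval_ad_apply hc, smul_eq_zero, Polynomial.eval_prod, Finset.prod_eq_zero_iff] at h1
  obtain ⟨n, hn, h2⟩ := h1.resolve_right hv0
  exact ⟨n, by simpa using hn, by simpa [sub_eq_zero] using h2⟩

/-- **Morozov's lemma**: if `h = [e, z]` and `[h, e] = 2e`, then `z` can be corrected by an element of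
the centralizer of `e` to complete `e` and `h` to an `sl₂`-triple. -/
theorem exists_isSl2Triple_of_lie_eq [FiniteDimensional K L] {e h z : L} (he0 : e ≠ 0)
    (hnil : IsNilpotent (LieAlgebra.ad K L e)) (hz : ⁅e, z⁆ = h) (he : ⁅h, e⁆ = 2 • e) :
    ∃ f, IsSl2Triple h e f := by
  obtain ⟨N, hN⟩ := hnil
  -- `T = ad h + 2` preserves `U = ker (ad e)` and is invertible there, as `-2` is not a weight.
  let U : Submodule K L := LinearMap.ker (LieAlgebra.ad K L e)
  have hU {v : L} : v ∈ U ↔ ⁅e, v⁆ = 0 := by simp [U]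
  let T : Module.End K L := LieAlgebra.ad K L h + (2 : K) • 1
  have hT (v : L) : T v = ⁅h, v⁆ + (2 : K) • v := by simp [T]
  have hTU : ∀ v ∈ U, T v ∈ U := by
    intro v hv
    rw [hU] at hv ⊢
    rw [hT, lie_add, lie_smul, hv, leibniz_lie, ← lie_skew e h, he, hv]
    simp [hv]
  have hinj : Function.Injective (T.restrict hTU) := by
    rw [injective_iff_map_eq_zero]
    rintro ⟨v, hv⟩ h0
    by_contra hne
    have h1 : ⁅h, v⁆ = (-2 : K) • v := by
      have : T v = 0 := congr(($h0 : L))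
      rw [hT] at this
      rw [neg_smul]
      exact eq_neg_of_add_eq_zero_left this
    obtain ⟨n, -, hn⟩ := exists_natCast_of_lie_eq_smul hz he hN (hU.1 hv) h1
      (fun h => hne (Subtype.ext h))
    have : ((n + 2 : ℕ) : K) = 0 := by push_cast; rw [← hn]; ring
    exact absurd (Nat.cast_eq_zero.1 this) (by omega)
  have hsurj := LinearMap.injective_iff_surjective.1 hinj
  have hx0 : ⁅h, z⁆ + (2 : K) • z ∈ U := by
    rw [hU, lie_add, lie_smul, leibniz_lie, hz, ← lie_skew e h, he, neg_lie, nsmul_lie, hz, lie_self,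
      ofNat_smul_eq_nsmul K]
    simp
  obtain ⟨⟨x, hx⟩, hxT⟩ := hsurj ⟨_, hx0⟩
  -- `T x = T z` says that `f = z - x` has weight `-2`.
  have hxT' : ⁅h, x⁆ + (2 : K) • x = ⁅h, z⁆ + (2 : K) • z := by
    rw [← hT]; exact congr(($hxT : L))
  refine ⟨z - x, ?_, ?_, he, ?_⟩
  · rintro rfl
    rw [zero_lie, ← ofNat_smul_eq_nsmul K] at he
    exact he0 ((smul_eq_zero.1 he.symm).resolve_left two_ne_zero)
  · rw [lie_sub, hU.1 hx, sub_zero, hz]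
  · rw [← ofNat_smul_eq_nsmul K, lie_sub, smul_sub, ← sub_eq_zero]
    rw [← sub_eq_zero] at hxT'
    rw [← neg_eq_zero, ← hxT']
    abel

/-- The **Jacobson-Morozov theorem** for Lie algebras with nondegenerate Killing form. -/
theorem exists_isSl2Triple_of_isKilling [FiniteDimensional K L] [LieAlgebra.IsKilling K L] {e : L}
    (he0 : e ≠ 0) (he : IsNilpotent (LieAlgebra.ad K L e)) : ∃ h f, IsSl2Triple h e f := by
  obtain ⟨y, hy⟩ := exists_lie_lie_eq_self he
  refine ⟨⁅e, -(2 • y)⁆, exists_isSl2Triple_of_lie_eq he0 he rfl ?_⟩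
  rw [lie_neg, neg_lie, lie_skew, lie_nsmul, lie_nsmul, hy]

end Morozov

/-! ### Central extensions of semisimple Lie algebras -/

section CentralExtension

variable {K L S : Type*} [Field K] [LieRing L] [LieAlgebra K L] [LieRing S]
  [LieAlgebra K S]

/-- A surjection `π` with central kernel onto a Lie algebra with nondegenerate Killing form `κ` is
injective on the derived algebra. For a linear form `l` on the source, `l [x, y]` is a 2-cocycle on
the target; it equals `κ (D (π x)) (π y)` for a derivation `D`, which is inner, say `D = ad d`. So
`l z = κ d (π z)` for all `z` in the derived algebra. -/
theorem eq_zero_of_mem_derivedSeries_of_map_eq_zero [FiniteDimensional K S]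
    [LieAlgebra.IsKilling K S] (π : L →ₗ⁅K⁆ S) (hπ : Function.Surjective π)
    (hker : ∀ x, π x = 0 → ∀ y : L, ⁅x, y⁆ = 0) {z : L}
    (hz : z ∈ LieAlgebra.derivedSeries K L 1) (hz0 : π z = 0) : z = 0 := by
  rw [← Module.forall_dual_apply_eq_zero_iff K]
  intro l
  have hker' (x y a : L) (h : π x = π y) : ⁅x, a⁆ = ⁅y, a⁆ := by
    have := hker (x - y) (by rw [map_sub, h, sub_self]) a
    rwa [sub_lie, sub_eq_zero] at this
  have hker'' (x y a : L) (h : π x = π y) : ⁅a, x⁆ = ⁅a, y⁆ := by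
    rw [← lie_skew, hker' x y a h, lie_skew]
  obtain ⟨s, hs⟩ := (π : L →ₗ[K] S).exists_rightInverse_of_surjective
    (LinearMap.range_eq_top.2 hπ)
  have hs' (a : S) : π (s a) = a := congr($hs a)
  set κ := killingForm K S
  have hnd : κ.Nondegenerate := LieAlgebra.IsKilling.killingForm_nondegenerate K S
  let B : S →ₗ[K] Module.Dual K S :=
    LinearMap.mk₂ K (fun a b => l ⁅s a, s b⁆) (by simp) (by simp) (by simp) (by simp)
  -- `D₀` is defined by `κ (D₀ a) b = l [s a, s b]`; by the Jacobi identity it is a derivation.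
  let D₀ : S →ₗ[K] S := (LinearMap.BilinForm.toDual κ hnd).symm.toLinearMap ∘ₗ B
  have hD₀ (a b : S) : κ (D₀ a) b = l ⁅s a, s b⁆ := by
    rw [← LinearMap.BilinForm.toDual_def hnd]
    simp [D₀, B]
  let D : LieDerivation K S S :=
    { toLinearMap := D₀
      leibniz' := by
        intro a b
        rw [← sub_eq_zero]
        refine hnd.1 _ fun c => ?_
        rw [map_sub, map_sub, LinearMap.sub_apply, LinearMap.sub_apply, hD₀,
          ← lie_skew a (D₀ b), ← lie_skew b (D₀ a), map_neg, map_neg, LinearMap.neg_apply,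
          LinearMap.neg_apply]
        simp only [κ, LieModule.traceForm_apply_lie_apply]
        change _ - (-κ (D₀ b) _ - -κ (D₀ a) _) = 0
        rw [hD₀, hD₀, hker' (s ⁅a, b⁆) ⁅s a, s b⁆ _ (by simp [hs']),
          hker'' (s ⁅a, c⁆) ⁅s a, s c⁆ _ (by simp [hs']),
          hker'' (s ⁅b, c⁆) ⁅s b, s c⁆ _ (by simp [hs']), lie_lie, map_sub]
        abel }
  obtain ⟨d, hd⟩ := LieDerivation.IsKilling.exists_eq_ad D
  have hD (a b : S) : κ d ⁅a, b⁆ = l ⁅s a, s b⁆ := by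
    rw [← hD₀, ← LieModule.traceForm_apply_lie_apply]
    change κ _ b = κ (D a) b
    rw [← hd, LieDerivation.ad_apply_apply]
  suffices h : (l : L →ₗ[K] K) z = (κ d ∘ₗ (π : L →ₗ[K] S)) z by
    rw [h]; simp [hz0]
  rw [LieAlgebra.derivedSeries_def, LieAlgebra.derivedSeriesOfIdeal_succ,
    LieAlgebra.derivedSeriesOfIdeal_zero, ← LieSubmodule.mem_toSubmodule,
    LieSubmodule.lieIdeal_oper_eq_linear_span'] at hz
  refine LinearMap.eqOn_span ?_ hz
  rintro _ ⟨x, -, y, -, rfl⟩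
  simp only [LinearMap.comp_apply, LieHom.coe_toLinearMap, LieHom.map_lie, hD]
  rw [hker' (s (π x)) x _ (hs' _), hker'' (s (π y)) y _ (hs' _)]

end CentralExtension

/-! ### The Jacobson-Morozov theorem for reductive Lie algebras -/

section Reductive

attribute [local instance] LieRing.ofAssociativeRing

variable {K L : Type*} [Field K] [LieRing L] [LieAlgebra K L]

theorem lie_mem_derivedSeries_one (x y : L) : ⁅x, y⁆ ∈ LieAlgebra.derivedSeries K L 1 :=
  LieSubmodule.lie_mem_lie (LieSubmodule.mem_top x) (LieSubmodule.mem_top y)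

variable [CharZero K]

/-- The preimage in `L` of an abelian ideal of `ad L` is solvable, hence contained in the radical, which
is the center and is killed by `ad`. -/
instance hasTrivialRadical_range_ad [FiniteDimensional K L] [LieAlgebra.HasCentralRadical K L] :
    LieAlgebra.HasTrivialRadical K (LieAlgebra.ad K L).range := by
  rw [LieAlgebra.hasTrivialRadical_iff_no_abelian_ideals]
  intro J hJ
  let I : LieIdeal K L := J.comap (LieAlgebra.ad K L).rangeRestrict
  have hI {x : L} : x ∈ I ↔ (LieAlgebra.ad K L).rangeRestrict x ∈ J := LieIdeal.mem_comap
  have hc {x y z : L} (hx : x ∈ I) (hy : y ∈ I) : ⁅⁅x, y⁆, z⁆ = 0 := by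
    have h1 : ⁅(LieAlgebra.ad K L).rangeRestrict x, (LieAlgebra.ad K L).rangeRestrict y⁆ = 0 :=
      congr(($(trivial_lie_zero J J ⟨_, hI.1 hx⟩ ⟨_, hI.1 hy⟩) : (LieAlgebra.ad K L).range))
    rw [← LieHom.map_lie] at h1
    exact congr(($h1 : Module.End K L) z)
  have hsol : LieAlgebra.IsSolvable I := by
    refine LieAlgebra.IsSolvable.mk (R := K) (k := 2) ?_
    rw [LieIdeal.derivedSeries_eq_bot_iff, LieAlgebra.derivedSeriesOfIdeal_succ,
      LieAlgebra.derivedSeriesOfIdeal_succ, LieAlgebra.derivedSeriesOfIdeal_zero,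
      LieSubmodule.lie_eq_bot_iff]
    intro x hx y hy
    have hx' : x ∈ LieAlgebra.center K L := by
      refine (LieSubmodule.lie_le_iff _ _ _).2 ?_ hx
      intro a ha b hb
      rw [LieModule.mem_maxTrivSubmodule]
      intro c
      rw [← lie_skew, hc ha hb, neg_zero]
    rw [← lie_skew, hx' y, neg_zero]
  have hle : I ≤ LieAlgebra.center K L := by
    rw [← LieAlgebra.HasCentralRadical.radical_eq_center]
    exact (LieAlgebra.LieIdeal.solvable_iff_le_radical K L I).1 hsol
  rw [LieSubmodule.eq_bot_iff]
  intro a ha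
  obtain ⟨x, rfl⟩ := (LieAlgebra.ad K L).surjective_rangeRestrict a
  have hx : x ∈ LieAlgebra.center K L := hle (hI.2 ha)
  refine Subtype.ext (LinearMap.ext fun y => ?_)
  change ⁅x, y⁆ = 0
  rw [← lie_skew, hx y, neg_zero]

theorem eq_zero_of_mem_derivedSeries_of_forall_lie_eq_zero [FiniteDimensional K L]
    [LieAlgebra.HasCentralRadical K L] {z : L} (hz : z ∈ LieAlgebra.derivedSeries K L 1)
    (hz0 : ∀ y : L, ⁅z, y⁆ = 0) : z = 0 :=
  eq_zero_of_mem_derivedSeries_of_map_eq_zero (LieAlgebra.ad K L).rangeRestrict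
    (LieAlgebra.ad K L).surjective_rangeRestrict
    (fun _ hx y => congr(($hx : Module.End K L) y)) hz
    (Subtype.ext (LinearMap.ext hz0))

/-- The **Jacobson-Morozov theorem** for reductive Lie algebras. -/
theorem exists_isSl2Triple_of_hasCentralRadical [FiniteDimensional K L]
    [LieAlgebra.HasCentralRadical K L] {e : L} (he0 : e ≠ 0)
    (hed : e ∈ LieAlgebra.derivedSeries K L 1) (he : IsNilpotent (LieAlgebra.ad K L e)) :
    ∃ h f, IsSl2Triple h e f := by
  set π := (LieAlgebra.ad K L).rangeRestrict
  have hπ : Function.Surjective π := (LieAlgebra.ad K L).surjective_rangeRestrict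
  have hinj {x y : L} (hx : x ∈ LieAlgebra.derivedSeries K L 1)
      (hy : y ∈ LieAlgebra.derivedSeries K L 1) (h : π x = π y) : x = y := by
    rw [← sub_eq_zero]
    refine eq_zero_of_mem_derivedSeries_of_forall_lie_eq_zero (sub_mem hx hy) fun a => ?_
    have : LieAlgebra.ad K L x = LieAlgebra.ad K L y := congr(($h : Module.End K L))
    rw [sub_lie, sub_eq_zero]
    exact congr($this a)
  have hmem (n : ℕ) {x : L} (hx : x ∈ LieAlgebra.derivedSeries K L 1) :
      n • x ∈ LieAlgebra.derivedSeries K L 1 := nsmul_mem hx n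
  have hπe : π e ≠ 0 := fun h => he0 (hinj hed (zero_mem _) (by rw [h, map_zero]))
  have hnil : IsNilpotent (LieAlgebra.ad K _ (π e)) := by
    obtain ⟨N, hN⟩ := he
    refine ⟨N, LinearMap.ext fun a => ?_⟩
    obtain ⟨x, rfl⟩ := hπ a
    have h (n : ℕ) : (LieAlgebra.ad K _ (π e) ^ n) (π x) = π ((LieAlgebra.ad K L e ^ n) x) := by
      induction n with
      | zero => simp
      | succ n ih => rw [pow_succ', pow_succ', Module.End.mul_apply, ih, Module.End.mul_apply,
          LieAlgebra.ad_apply, LieAlgebra.ad_apply, LieHom.map_lie]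
    rw [h, hN, LinearMap.zero_apply, map_zero, LinearMap.zero_apply]
  obtain ⟨h', f', t⟩ := exists_isSl2Triple_of_isKilling hπe hnil
  obtain ⟨y, rfl⟩ := hπ f'
  -- `[e, y]` and `e` lie in the derived algebra, so relations between them can be checked in `ad L`.
  have hh : π ⁅e, y⁆ = h' := by rw [LieHom.map_lie, t.lie_e_f]
  refine ⟨⁅e, y⁆, exists_isSl2Triple_of_lie_eq he0 he rfl ?_⟩
  refine hinj (lie_mem_derivedSeries_one _ _) (hmem 2 hed) ?_
  rw [LieHom.map_lie, hh, t.lie_h_e_nsmul, map_nsmul]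

end Reductive

/-! ### The weight filtration of the centralizer -/

section Filtration

variable {K L : Type*} [Field K] [LieRing L] [LieAlgebra K L]

variable (K) in
/-- The span of the vectors of the centralizer of `e` of weight `n ≥ k` with respect to `ad h`. -/
def centralizerFiltration (e h : L) (k : ℕ) : Submodule K L :=
  Submodule.span K {x | ⁅e, x⁆ = 0 ∧ ∃ n ≥ k, ⁅h, x⁆ = (n : K) • x}

theorem mem_centralizerFiltration {e h x : L} {n k : ℕ} (hx : ⁅e, x⁆ = 0)
    (hn : ⁅h, x⁆ = (n : K) • x) (hk : k ≤ n) : x ∈ centralizerFiltration K e h k :=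
  Submodule.subset_span ⟨hx, n, hk, hn⟩

theorem centralizerFiltration_anti (e h : L) {k l : ℕ} (hkl : k ≤ l) :
    centralizerFiltration K e h l ≤ centralizerFiltration K e h k :=
  Submodule.span_mono fun _ ⟨hx, n, hn, hhx⟩ => ⟨hx, n, hkl.trans hn, hhx⟩

/-- Vectors of the centralizer of weight `n` raise the filtration degree by `n`. -/
theorem lie_mem_centralizerFiltration {e h x y : L} {n l : ℕ} (hx : ⁅e, x⁆ = 0)
    (hn : ⁅h, x⁆ = (n : K) • x) (hy : y ∈ centralizerFiltration K e h l) :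
    ⁅x, y⁆ ∈ centralizerFiltration K e h (n + l) := by
  induction hy using Submodule.span_induction with
  | mem y hy =>
    obtain ⟨hy, m, hm, hhy⟩ := hy
    refine mem_centralizerFiltration (n := n + m) ?_ ?_ (by omega)
    · rw [leibniz_lie, hx, hy, zero_lie, lie_zero, add_zero]
    · rw [leibniz_lie, hn, hhy, smul_lie, lie_smul, Nat.cast_add, add_smul]
  | zero => simp
  | add y z _ _ hy hz => rw [lie_add]; exact add_mem hy hz
  | smul c y _ hy => rw [lie_smul]; exact Submodule.smul_mem _ _ hy

theorem exists_sub_mem_centralizerFiltration_succ {e h w : L} {k : ℕ}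
    (hw : w ∈ centralizerFiltration K e h k) :
    ∃ x, ⁅e, x⁆ = 0 ∧ ⁅h, x⁆ = (k : K) • x ∧ w - x ∈ centralizerFiltration K e h (k + 1) := by
  induction hw using Submodule.span_induction with
  | mem w hw =>
    obtain ⟨hw, n, hn, hhw⟩ := hw
    rcases hn.eq_or_lt with rfl | hlt
    · exact ⟨w, hw, hhw, by simp⟩
    · exact ⟨0, by simp, by simp, by simpa using mem_centralizerFiltration hw hhw hlt⟩
  | zero => exact ⟨0, by simp⟩
  | add v w _ _ hv hw =>
    obtain ⟨x, hx, hhx, hvx⟩ := hv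
    obtain ⟨y, hy, hhy, hwy⟩ := hw
    refine ⟨x + y, by rw [lie_add, hx, hy, add_zero], by rw [lie_add, hhx, hhy, smul_add], ?_⟩
    rw [add_sub_add_comm]
    exact add_mem hvx hwy
  | smul c w _ hw =>
    obtain ⟨x, hx, hhx, hwx⟩ := hw
    refine ⟨c • x, by rw [lie_smul, hx, smul_zero], by rw [lie_smul, hhx, smul_comm], ?_⟩
    rw [← smul_sub]
    exact Submodule.smul_mem _ _ hwx

variable [CharZero K]

/-- The operator `ad h` is diagonalizable on the vectors killed by a product of distinct linear factors
in `ad h`; here the decomposition stays inside the centralizer of `e`. -/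
theorem mem_centralizerFiltration_of_aeval_eq_zero {e h : L} (he : ⁅h, e⁆ = 2 • e) (d : ℕ) {m : ℕ}
    {v : L} (hv : ⁅e, v⁆ = 0)
    (h0 : Polynomial.aeval (LieAlgebra.ad K L h) (∏ k ∈ Finset.Ico m (m + d),
      (Polynomial.X - Polynomial.C (k : K))) v = 0) : v ∈ centralizerFiltration K e h m := by
  induction d generalizing m v with
  | zero =>
    have : v = 0 := by simpa using h0
    rw [this]; exact zero_mem _
  | succ d ih =>
    have hstab (P : Polynomial K) {u : L} (hu : ⁅e, u⁆ = 0) :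
        ⁅e, Polynomial.aeval (LieAlgebra.ad K L h) P u⁆ = 0 := by
      induction P using Polynomial.induction_on' with
      | add P Q hP hQ => rw [map_add, LinearMap.add_apply, lie_add, hP, hQ, add_zero]
      | monomial n a =>
        rw [Polynomial.aeval_monomial, Module.End.mul_apply, Module.algebraMap_end_apply, lie_smul]
        suffices hn : ⁅e, (LieAlgebra.ad K L h ^ n) u⁆ = 0 by rw [hn, smul_zero]
        induction n with
        | zero => simpa using hu
        | succ n ihn =>
          rw [pow_succ', Module.End.mul_apply, LieAlgebra.ad_apply, leibniz_lie, ihn,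
            ← lie_skew e h, he, neg_lie, nsmul_lie, ihn]
          simp
    rw [Finset.prod_eq_prod_Ico_succ_bot (by omega), ← add_assoc, add_right_comm, map_mul,
      Module.End.mul_apply] at h0
    -- `y` is, up to the scalar `Q(m)`, the component of `v` of weight `m`.
    set Q : Polynomial K := ∏ k ∈ Finset.Ico (m + 1) (m + 1 + d),
      (Polynomial.X - Polynomial.C (k : K)) with hQ
    set y := Polynomial.aeval (LieAlgebra.ad K L h) Q v with hy
    have hey : ⁅e, y⁆ = 0 := hstab Q hv
    have hhy : ⁅h, y⁆ = (m : K) • y := by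
      rw [← sub_eq_zero, Nat.cast_smul_eq_nsmul]
      simpa using h0
    have hQm : Q.eval (m : K) ≠ 0 := by
      rw [hQ, Polynomial.eval_prod, Finset.prod_ne_zero_iff]
      intro k hk
      rw [Finset.mem_Ico] at hk
      simp only [Polynomial.eval_sub, Polynomial.eval_X, Polynomial.eval_C, ne_eq, sub_eq_zero,
        Nat.cast_inj]
      omega
    have hy' : (Q.eval (m : K))⁻¹ • y ∈ centralizerFiltration K e h m :=
      Submodule.smul_mem _ _ (mem_centralizerFiltration hey hhy le_rfl)
    rw [← sub_add_cancel v ((Q.eval (m : K))⁻¹ • y)]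
    refine add_mem (centralizerFiltration_anti e h m.le_succ (ih ?_ ?_)) hy'
    · rw [lie_sub, hv, lie_smul, hey, smul_zero, sub_zero]
    · rw [map_sub, map_smul, aeval_ad_apply hhy, inv_smul_smul₀ hQm, sub_self]

/-- The weights on the intersection of the kernel and the image of `ad e` are strictly positive. -/
theorem ker_inf_range_le_centralizerFiltration {e h z v w : L} (hz : ⁅e, z⁆ = h)
    (he : ⁅h, e⁆ = 2 • e) (hnil : IsNilpotent (LieAlgebra.ad K L e)) (hv : ⁅e, v⁆ = 0)
    (hw : ⁅e, w⁆ = v) : v ∈ centralizerFiltration K e h 1 := by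
  obtain ⟨N, hN⟩ := hnil
  refine mem_centralizerFiltration_of_aeval_eq_zero he N hv ?_
  exact prod_sub_ad_apply_eq_zero hz he (by omega) (by rw [pow_add, hN, mul_zero]) hv
    ⟨w, by simpa using hw⟩

theorem exists_centralizerFiltration_eq_bot {e h z : L} (hz : ⁅e, z⁆ = h)
    (he : ⁅h, e⁆ = 2 • e) (hnil : IsNilpotent (LieAlgebra.ad K L e)) :
    ∃ k, centralizerFiltration K e h k = ⊥ := by
  obtain ⟨N, hN⟩ := hnil
  refine ⟨N, ?_⟩
  rw [centralizerFiltration, Submodule.span_eq_bot]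
  rintro x ⟨hx, n, hn, hhx⟩
  by_contra hx0
  obtain ⟨m, hm, hmn⟩ := exists_natCast_of_lie_eq_smul hz he hN hx hhx hx0
  rw [Nat.cast_inj] at hmn
  omega

end Filtration

/-- The nonzero powers of `ad x` would be eigenvectors of `[ad h, ·]` for the infinitely many
eigenvalues `n c`. -/
theorem isNilpotent_ad_of_lie_eq_smul {K L : Type*} [Field K] [CharZero K] [LieRing L]
    [LieAlgebra K L] [FiniteDimensional K L] {h x : L} {c : K} (hc : c ≠ 0) (hx : ⁅h, x⁆ = c • x) :
    IsNilpotent (LieAlgebra.ad K L x) := by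
  set E := LieAlgebra.ad K L x with hE
  set H := LieAlgebra.ad K L h with hH
  have h1 : H * E - E * H = c • E := by rw [hE, hH, ad_mul_sub_mul_ad, hx, map_smul]
  have h2 (n : ℕ) : H * E ^ n - E ^ n * H = (n * c) • E ^ n := by
    induction n with
    | zero => simp
    | succ n ih =>
      have : H * E ^ (n + 1) - E ^ (n + 1) * H
          = (H * E ^ n - E ^ n * H) * E + E ^ n * (H * E - E * H) := by
        rw [pow_succ]; noncomm_ring
      rw [this, ih, h1, smul_mul_assoc, ← pow_succ, mul_smul_comm, ← pow_succ, ← add_smul]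
      push_cast; ring_nf
  by_contra hnil
  have h3 (n : ℕ) : Module.End.HasEigenvalue
      (LinearMap.mulLeft K H - LinearMap.mulRight K H) (n * c : K) := by
    refine Module.End.hasEigenvalue_of_hasEigenvector (x := E ^ n) ⟨?_, fun h => hnil ⟨n, h⟩⟩
    rw [Module.End.mem_eigenspace_iff]
    simpa using h2 n
  refine Set.infinite_of_injective_forall_mem (f := fun n : ℕ => (n * c : K)) ?_ h3
    (Module.End.finite_hasEigenvalue _)
  intro a b hab
  simpa [hc] using hab

/-! ### Exponentials in the adjoint group and conjugacy of triples -/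

section AdjointGroup

variable {𝔤 : Type*} [LieRing 𝔤] [LieAlgebra ℂ 𝔤] [FiniteDimensional ℂ 𝔤]

theorem expEnd_eq_sum {A : Module.End ℂ 𝔤} {n : ℕ} (hA : A ^ n = 0) :
    expEnd A = ∑ i ∈ Finset.range n, ((i.factorial : ℂ)⁻¹) • A ^ i := by
  unfold expEnd
  let : TopologicalSpace (Module.End ℂ 𝔤) := moduleTopology ℂ (Module.End ℂ 𝔤)
  have : IsModuleTopology ℂ (Module.End ℂ 𝔤) := ⟨rfl⟩
  have : IsTopologicalRing (Module.End ℂ 𝔤) :=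
    IsModuleTopology.isTopologicalRing ℂ (Module.End ℂ 𝔤)
  rw [NormedSpace.exp_eq_tsum ℂ]
  refine tsum_eq_sum fun i hi => ?_
  rw [pow_eq_zero_of_le (by simpa using hi) hA, smul_zero]

/-- If `ad x` is nilpotent, the finite exponential sum of `ad x` is the action of an element of the
adjoint group. -/
theorem exists_adjointGroup_smul_eq_sum {x : 𝔤} {n : ℕ} (hx : LieAlgebra.ad ℂ 𝔤 x ^ n = 0) :
    ∃ g : adjointGroup 𝔤, ∀ v : 𝔤, g • v =
      ∑ i ∈ Finset.range n, ((i.factorial : ℂ)⁻¹) • (LieAlgebra.ad ℂ 𝔤 x ^ i) v := by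
  let : Module ℚ 𝔤 := Module.compHom 𝔤 (algebraMap ℚ ℂ)
  let : LieAlgebra ℚ 𝔤 := { lie_smul := fun q a b => lie_smul (q : ℂ) a b }
  let D : LieDerivation ℂ 𝔤 𝔤 := LieDerivation.ad ℂ 𝔤 x
  have hD : D.toLinearMap = LieAlgebra.ad ℂ 𝔤 x := by ext; simp [D]
  have hnil : IsNilpotent D.toLinearMap := ⟨n, by rw [hD, hx]⟩
  let φ := LieDerivation.exp D hnil
  have hφ : (φ.toLinearEquiv : 𝔤 →ₗ[ℂ] 𝔤) = expEnd (LieAlgebra.ad ℂ 𝔤 x) := by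
    have h1 : (φ.toLinearEquiv : 𝔤 →ₗ[ℂ] 𝔤) = IsNilpotent.exp D.toLinearMap := rfl
    rw [h1, hD, IsNilpotent.exp_eq_sum hx, expEnd_eq_sum hx]
    refine Finset.sum_congr rfl fun i _ => ?_
    ext v
    change (((i.factorial : ℚ)⁻¹ : ℚ) : ℂ) • (LieAlgebra.ad ℂ 𝔤 x ^ i) v = _
    simp
  refine ⟨⟨⟨φ.toLinearEquiv, fun a b => φ.map_lie a b⟩, Subgroup.subset_closure ⟨x, hφ⟩⟩,
    fun v => ?_⟩
  change (φ.toLinearEquiv : 𝔤 →ₗ[ℂ] 𝔤) v = _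
  rw [hφ, expEnd_eq_sum hx]
  simp [LinearMap.sum_apply]

/-- For nilpotent `ad x`, the element `g = exp (ad x)` of the adjoint group fixes the centralizer of
`x`, and `g v ≡ v + [x, v]` modulo any `ad x`-stable subspace containing `[x, [x, v]]`. -/
theorem exists_adjointGroup_smul_sub_mem {x : 𝔤} (hx : IsNilpotent (LieAlgebra.ad ℂ 𝔤 x)) :
    ∃ g : adjointGroup 𝔤, (∀ v : 𝔤, ⁅x, v⁆ = 0 → g • v = v) ∧
      ∀ (S : Submodule ℂ 𝔤) (v : 𝔤), (∀ s ∈ S, ⁅x, s⁆ ∈ S) → ⁅x, ⁅x, v⁆⁆ ∈ S →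
        g • v - v - ⁅x, v⁆ ∈ S := by
  obtain ⟨n, hn⟩ := hx
  obtain ⟨g, hg⟩ := exists_adjointGroup_smul_eq_sum (n := n + 2) (by rw [pow_add, hn, zero_mul])
  have hg' (v : 𝔤) : g • v - v - ⁅x, v⁆ = ∑ i ∈ Finset.range n,
      (((i + 2).factorial : ℂ)⁻¹) • (LieAlgebra.ad ℂ 𝔤 x ^ i) ⁅x, ⁅x, v⁆⁆ := by
    rw [hg, Finset.sum_range_succ', Finset.sum_range_succ']
    simp [pow_succ]
  refine ⟨g, fun v hv => ?_, fun S v hS hv => ?_⟩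
  · have := hg' v
    simpa [hv, sub_eq_zero] using this
  · rw [hg']
    refine Submodule.sum_mem _ fun i hi => Submodule.smul_mem _ _ ?_
    clear hi
    induction i with
    | zero => simpa using hv
    | succ i ih => rw [pow_succ']; exact hS _ ih

/-- Given two triples with the same `e`, the element `h` can be moved to `h'` modulo any given step of
the filtration by elements of the adjoint group fixing `e`. -/
theorem exists_smul_sub_mem_centralizerFiltration (t t' : SlTwoTriple 𝔤) (ht : t.e = t'.e) (k : ℕ) :
    ∃ g : adjointGroup 𝔤, g • t.e = t.e ∧
      t'.h - g • t.h ∈ centralizerFiltration ℂ t.e t.h (k + 1) := by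
  have hh : t'.h - t.h ∈ centralizerFiltration ℂ t.e t.h 1 := by
    refine ker_inf_range_le_centralizerFiltration t.isSl2Triple.lie_e_f
      t.isSl2Triple.lie_h_e_nsmul (isNilpotent_ad_e t) (w := t'.f - t.f) ?_ ?_
    · rw [lie_sub, ← lie_skew, ← lie_skew t.e t.h, t.isSl2Triple.lie_h_e_nsmul, ht,
        t'.isSl2Triple.lie_h_e_nsmul, sub_self]
    · rw [lie_sub, t.isSl2Triple.lie_e_f, ht, t'.isSl2Triple.lie_e_f]
  induction k with
  | zero => exact ⟨1, one_smul _ _, by simpa using hh⟩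
  | succ k ih =>
    obtain ⟨g, hge, hgh⟩ := ih
    obtain ⟨w, hew, hhw, hw⟩ := exists_sub_mem_centralizerFiltration_succ hgh
    have hk : ((k + 1 : ℕ) : ℂ) ≠ 0 := by exact_mod_cast k.succ_ne_zero
    -- `w` is the leading term, of weight `k + 1`, of the error; `x` is chosen so that `[x, h] = w`.
    set x := -(((k + 1 : ℕ) : ℂ)⁻¹ • w) with hxdef
    have hex : ⁅t.e, x⁆ = 0 := by rw [hxdef, lie_neg, lie_smul, hew, smul_zero, neg_zero]
    have hhx : ⁅t.h, x⁆ = ((k + 1 : ℕ) : ℂ) • x := by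
      rw [hxdef, lie_neg, lie_smul, hhw, smul_neg, smul_comm]
    have hxh : ⁅x, t.h⁆ = w := by
      rw [← lie_skew, hhx, hxdef, smul_neg, neg_neg, smul_inv_smul₀ hk]
    set F := centralizerFiltration ℂ t.e t.h
    have hF {l : ℕ} {y : 𝔤} (hy : y ∈ F l) : ⁅x, y⁆ ∈ F (k + 1 + l) :=
      lie_mem_centralizerFiltration hex hhx hy
    have hle {i j : ℕ} (hij : i ≤ j) : F j ≤ F i := centralizerFiltration_anti _ _ hij
    obtain ⟨g', hg'e, hg'⟩ := exists_adjointGroup_smul_sub_mem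
      (isNilpotent_ad_of_lie_eq_smul hk hhx)
    have h1 : ⁅x, g • t.h⁆ - w ∈ F (k + 2) := by
      have h2 : g • t.h - t.h ∈ F 1 := by
        have h2' := sub_mem hh (hle (Nat.le_add_left 1 k) hgh)
        rwa [sub_sub_sub_cancel_left] at h2'
      have h2' := hF h2
      rwa [lie_sub, hxh] at h2'
    have h3 : ⁅x, ⁅x, g • t.h⁆⁆ ∈ F (k + 2) := by
      have h3' : ⁅x, ⁅x, g • t.h⁆ - w⁆ + ⁅x, w⁆ ∈ F (k + 2) :=
        add_mem (hle (by omega) (hF h1))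
          (hle (by omega) (hF (mem_centralizerFiltration hew hhw le_rfl)))
      rwa [lie_sub, sub_add_cancel] at h3'
    refine ⟨g' * g, ?_, ?_⟩
    · rw [mul_smul, hge]
      exact hg'e _ (by rw [← lie_skew, hex, neg_zero])
    · have h4 := hg' (F (k + 2)) (g • t.h) (fun s hs => hle (by omega) (hF hs)) h3
      have h5 := sub_mem (sub_mem hw h1) h4
      rw [mul_smul]
      convert h5 using 1
      abel

theorem SlTwoTriple.eq_of_e_eq_of_h_eq {t t' : SlTwoTriple 𝔤} (he : t.e = t'.e) (hh : t.h = t'.h) :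
    t = t' := by
  refine SlTwoTriple.ext he hh ?_
  rw [← sub_eq_zero]
  by_contra hne
  obtain ⟨N, hN⟩ := isNilpotent_ad_e t
  obtain ⟨n, -, hn⟩ := exists_natCast_of_lie_eq_smul (K := ℂ) t.isSl2Triple.lie_e_f
    t.isSl2Triple.lie_h_e_nsmul hN (v := t.f - t'.f) (c := -2)
    (by rw [lie_sub, t.isSl2Triple.lie_e_f, he, t'.isSl2Triple.lie_e_f, hh, sub_self])
    (by rw [lie_sub, t.isSl2Triple.lie_lie_smul_f ℂ, hh, t'.isSl2Triple.lie_lie_smul_f ℂ, neg_smul,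
      smul_sub, neg_sub_neg, neg_sub]) hne
  have : ((n + 2 : ℕ) : ℂ) = 0 := by push_cast; rw [← hn]; ring
  exact absurd (Nat.cast_eq_zero.1 this) (by omega)

/-- **Kostant's theorem**: `sl₂`-triples with the same nilpositive element are conjugate. -/
theorem exists_smul_eq_of_e_eq (t t' : SlTwoTriple 𝔤) (ht : t.e = t'.e) :
    ∃ g : adjointGroup 𝔤, g • t = t' := by
  obtain ⟨k, hk⟩ := exists_centralizerFiltration_eq_bot (K := ℂ) t.isSl2Triple.lie_e_f
    t.isSl2Triple.lie_h_e_nsmul (isNilpotent_ad_e t)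
  obtain ⟨g, hge, hgh⟩ := exists_smul_sub_mem_centralizerFiltration t t' ht k
  refine ⟨g, SlTwoTriple.eq_of_e_eq_of_h_eq (hge.trans ht) ?_⟩
  have h0 := centralizerFiltration_anti _ _ k.le_succ hgh
  rw [hk, Submodule.mem_bot, sub_eq_zero] at h0
  exact h0.symm

theorem Omega_injective : Function.Injective (Omega 𝔤) := by
  rintro ⟨t⟩ ⟨t'⟩ h
  have h1 : MulAction.orbit (adjointGroup 𝔤) t.e = MulAction.orbit (adjointGroup 𝔤) t'.e :=
    congr(($h : Set 𝔤))
  obtain ⟨g, hg⟩ := MulAction.orbit_eq_iff.1 h1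
  obtain ⟨g', hg'⟩ := exists_smul_eq_of_e_eq (g • t') t hg
  exact Quotient.sound ⟨g' * g, by rw [← hg', ← mul_smul]⟩

theorem Omega_surjective [LieAlgebra.HasCentralRadical ℂ 𝔤] :
    Function.Surjective (Omega 𝔤) := by
  rintro ⟨_, e, he0, ⟨hed, he⟩, rfl⟩
  obtain ⟨h, f, t⟩ := exists_isSl2Triple_of_hasCentralRadical he0 hed he
  exact ⟨Quotient.mk _ ⟨e, h, f, t⟩, rfl⟩

end AdjointGroup

end NilpotentOrbits

/-- The map `Ω` from conjugacy classes of sl₂-triples to nonzero nilpotent orbits of a finite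
dimensional complex reductive Lie algebra is a bijection. -/
theorem theorem2p8 (𝔤 : Type*) [LieRing 𝔤] [LieAlgebra ℂ 𝔤] [FiniteDimensional ℂ 𝔤]
    [LieAlgebra.HasCentralRadical ℂ 𝔤] :
    Function.Bijective (NilpotentOrbits.Omega 𝔤) :=
  ⟨NilpotentOrbits.Omega_injective, NilpotentOrbits.Omega_surjective⟩
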